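/- Let $R$ be a finite chain ring, that is, a finite commutative ring with $1\neq 0$ whose ideals are totally ordered by inclusion. Let $\gamma$ be a generator of its maximal ideal, let $e$ be the nilpotency index of $\gamma$ (the least $e$ with $\gamma^e=0$), and suppose that $e$ is even. Let the residue field $K=R/\langle\gamma\rangle$ have $p^r$ elements, $p$ prime. Let $n=\ell^a$ with $\ell$ an odd prime and $a\ge 1$, and suppose $\gcd(n,p)=1$. A linear code of length $n$ over $R$ is an $R$-submodule $C\subseteq R^n$; it is cyclic if $(c_{n-1},c_0,\dots,c_{n-2})\in C$ whenever $(c_0,\dots,c_{n-1})\in C$, and self-dual if $C=C^\perp=\{u\in R^n : \sum_i u_iv_i=0 \text{ for all } v\in C\}$. A self-dual code is called non-trivial if it is different from the code with generator matrix $\gamma^{e/2}I_n$, i.e. from $\gamma^{e/2}R^n$. Then there exists a non-trivial cyclic self-dual code of length $n$ over $R$ if and only if $\operatorname{ord}_n(p^r)$, the multiplicative order of $p^r$ modulo $n$, is odd. -/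

import Mathlib

/-- A finite chain ring: a finite commutative ring with `1 ≠ 0` whose ideals are totally ordered
by inclusion. -/
structure IsFiniteChainRing (R : Type*) [CommRing R] : Prop where
  finite : Finite R
  nontrivial : Nontrivial R
  ideals_chain : ∀ I J : Ideal R, I ≤ J ∨ J ≤ I

/-- A linear code of length `n` over `R` is an `R`-submodule of `Rⁿ`. -/
abbrev LinearCode (R : Type*) [CommRing R] (n : ℕ) := Submodule R (Fin n → R)

namespace LinearCode

variable {R : Type*} [CommRing R] {n : ℕ}

/-- The dual code with respect to the standard inner product `[u, v] = ∑ uᵢ vᵢ`. -/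
def dual (C : LinearCode R n) : LinearCode R n where
  carrier := {u | ∀ v ∈ C, u ⬝ᵥ v = 0}
  add_mem' := by
    intro a b ha hb v hv
    rw [add_dotProduct, ha v hv, hb v hv, add_zero]
  zero_mem' := by
    intro v _
    exact zero_dotProduct v
  smul_mem' := by
    intro c a ha v hv
    rw [smul_dotProduct, ha v hv, smul_zero]

/-- A code is self-dual if it equals its dual. -/
def IsSelfDual (C : LinearCode R n) : Prop := C = C.dual

/-- A code is cyclic if `(c_{n-1}, c_0, …, c_{n-2})` lies in it whenever `(c_0, …, c_{n-1})` does.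
Here `finRotate n` is the permutation `i ↦ i + 1` of the indices modulo `n`. -/
def IsCyclic (C : LinearCode R n) : Prop :=
  ∀ c ∈ C, (fun i => c ((finRotate n).symm i)) ∈ C

variable (n) in
/-- The trivial self-dual code of length `n`, with generator matrix `γ ^ (e / 2) Iₙ`, where `γ`
generates the maximal ideal and has (even) nilpotency index `e`. -/
def trivialSelfDual (γ : R) (e : ℕ) : LinearCode R n :=
  Submodule.span R (Set.range (γ ^ (e / 2) • (1 : Matrix (Fin n) (Fin n) R)).row)

end LinearCode

/-! ### Finite chain rings -/

/-! Put q = |K|, e = 2m. A word is an element of the group ring R[ℤ/n], a cyclic code is an ideal,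
and u is orthogonal to every shift of v exactly when u * rev v = 0. As n is an odd prime power, ±1
are the only square roots of 1 mod n, so the order of q is odd iff no q^j is -1.

If q^j = -1, then on K[ℤ/n] `rev` is the Frobenius power x ↦ x^(q^j), so x * rev x = 0 makes x
nilpotent, hence 0. Removing factors γ one at a time puts every word of a self-orthogonal cyclic
code into γ^m Rⁿ, and self-duality then forces the trivial code
(`exists_pow_smul_of_mul_rev_eq_zero`).

If no q^j is -1, a primitive n-th root of unity ζ is not conjugate to ζ⁻¹ over K, which yields a
nonzero x in K[ℤ/n] with x * rev x = 0 (`exists_ne_zero_mul_rev_eq_zero`). It leads to an idempotent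
E ≠ 0 over R with E * rev E = 0, and E together with γ^m (1 - E - rev E) generates a self-dual
ideal. It is not trivial, because words of γ^m Rⁿ square to 0 in the group ring. -/

theorem IsFiniteChainRing.isLocalRing {R : Type*} [CommRing R] (hR : IsFiniteChainRing R) :
    IsLocalRing R := by
  have := hR.nontrivial
  obtain ⟨m, hm⟩ := Ideal.exists_maximal R
  refine IsLocalRing.of_unique_max_ideal ⟨m, hm, fun J hJ => ?_⟩
  rcases hR.ideals_chain J m with h | h
  · exact hJ.eq_of_le hm.ne_top h
  · exact (hm.eq_of_le hJ.ne_top h).symm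

theorem IsFiniteChainRing.isUnit_of_not_dvd {R : Type*} [CommRing R] (hR : IsFiniteChainRing R)
    {γ : R} (hγ : (Ideal.span {γ}).IsMaximal) {s : R} (hs : ¬ γ ∣ s) : IsUnit s := by
  have := hR.isLocalRing
  by_contra h
  apply hs
  rw [← Ideal.mem_span_singleton, IsLocalRing.eq_maximalIdeal hγ]
  exact h

/-- Every element of a finite monoid has an idempotent power. -/
theorem exists_pow_isIdempotentElem {M : Type*} [Monoid M] [Finite M] (a : M) :
    ∃ N, 0 < N ∧ IsIdempotentElem (a ^ N) := by
  obtain ⟨i, j, hij, h⟩ : ∃ i j : ℕ, i < j ∧ a ^ i = a ^ j := by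
    obtain ⟨i, j, hne, h⟩ := Finite.exists_ne_map_eq_of_infinite (fun k : ℕ => a ^ k)
    rcases lt_or_gt_of_ne hne with hlt | hlt
    · exact ⟨i, j, hlt, h⟩
    · exact ⟨j, i, hlt, h.symm⟩
  obtain ⟨d, rfl⟩ := Nat.exists_eq_add_of_lt hij
  have step : ∀ m, i ≤ m → ∀ k, a ^ (m + k * (d + 1)) = a ^ m := by
    intro m hm k
    obtain ⟨c, rfl⟩ := Nat.exists_eq_add_of_le hm
    induction k with
    | zero => simp
    | succ k ih =>
      rw [← ih, show i + c + (k + 1) * (d + 1) = (i + d + 1) + (c + k * (d + 1)) by ring, pow_add,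
        ← h, ← pow_add]
      congr 1
      ring
  -- From exponent i on, powers of a have period d + 1; this exponent is a positive multiple of the
  -- period and at least i.
  refine ⟨(i + 1) * (d + 1), by positivity, ?_⟩
  rw [IsIdempotentElem, ← pow_add]
  exact step _ (by nlinarith) _

/-- Some power γ^N is idempotent, and 1 - γ^N is a unit that kills it. -/
theorem IsFiniteChainRing.isNilpotent {R : Type*} [CommRing R] (hR : IsFiniteChainRing R)
    {γ : R} (hγ : (Ideal.span {γ}).IsMaximal) : IsNilpotent γ := by
  have := hR.finite
  obtain ⟨N, hN, h⟩ := exists_pow_isIdempotentElem γ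
  refine ⟨N, ?_⟩
  have hu : IsUnit (1 - γ ^ N) := by
    refine hR.isUnit_of_not_dvd hγ fun hd => ?_
    have h1 : γ ∣ 1 := by
      have := dvd_add hd (dvd_pow_self γ hN.ne')
      rwa [sub_add_cancel] at this
    exact hγ.ne_top ((Ideal.eq_top_iff_one _).2 (Ideal.mem_span_singleton.2 h1))
  refine hu.mul_left_eq_zero.1 ?_
  rw [mul_sub, mul_one, h.eq, sub_self]

/-- If r = γ^i s with i < j and γ ∤ s, then s is a unit, so γ^(k+i) = 0 below the nilpotency index.
-/
theorem IsFiniteChainRing.dvd_of_pow_mul_eq_zero {R : Type*} [CommRing R]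
    (hR : IsFiniteChainRing R) {γ : R} (hγ : (Ideal.span {γ}).IsMaximal) {j k : ℕ}
    (hjk : j + k ≤ nilpotencyClass γ) {r : R} (h : γ ^ k * r = 0) : γ ^ j ∣ r := by
  induction j with
  | zero => simp
  | succ j ih =>
    obtain ⟨s, rfl⟩ := ih (by omega)
    rw [pow_succ]
    refine mul_dvd_mul_left _ ?_
    by_contra hs
    have hu := hR.isUnit_of_not_dvd hγ hs
    rw [← mul_assoc, ← pow_add, hu.mul_left_eq_zero] at h
    have := csInf_le (OrderBot.bddBelow _) (show k + j ∈ {k | γ ^ k = 0} from h)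
    rw [nilpotencyClass] at hjk
    omega

namespace AddMonoidAlgebra

/-! ### Group rings of finite abelian groups -/

theorem finite {R G : Type*} [CommRing R] [Finite G] [Finite R] :
    Finite (AddMonoidAlgebra R G) :=
  Finite.of_injective (fun x => (x.coeff : G → R))
    (DFunLike.coe_injective.comp coeff_injective)

section Basic

variable {R G : Type*} [CommRing R] [AddCommGroup G]

/-- The involution of a group ring induced by `g ↦ -g`. -/
noncomputable def rev : AddMonoidAlgebra R G →+* AddMonoidAlgebra R G :=
  mapDomainRingHom R negAddMonoidHom

@[simp] theorem rev_single (g : G) (r : R) : rev (single g r) = single (-g) r := by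
  simp [rev]

@[simp] theorem rev_rev (x : AddMonoidAlgebra R G) : rev (rev x) = x := by
  induction x using induction_linear with
  | zero => simp
  | add x y hx hy => simp [hx, hy]
  | single g r => simp

theorem rev_smul (r : R) (x : AddMonoidAlgebra R G) : rev (r • x) = r • rev x := by
  induction x using induction_linear with
  | zero => simp
  | add x y hx hy => simp [hx, hy]
  | single g s => simp

theorem coeff_rev (x : AddMonoidAlgebra R G) (g : G) : (rev x).coeff g = x.coeff (-g) := by
  induction x using induction_linear with
  | zero => simp
  | add x y hx hy => simp [hx, hy]
  | single h s =>
    classical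
    simp [Finsupp.single_apply, neg_eq_iff_eq_neg]

theorem coeff_mul_rev [Fintype G] (x y : AddMonoidAlgebra R G) (g : G) :
    (x * rev y).coeff g = ∑ i, x.coeff i * y.coeff (i - g) := by
  rw [coeff_mul_apply_left, Finsupp.sum_fintype _ _ (by simp)]
  refine Finset.sum_congr rfl fun i _ => ?_
  rw [coeff_rev]
  congr 2
  abel

theorem exists_smul_eq_of_forall_dvd [Finite G] {r : R} {x : AddMonoidAlgebra R G}
    (h : ∀ g, r ∣ x.coeff g) : ∃ y, x = r • y := by
  choose f hf using h
  exact ⟨ofCoeff (Finsupp.equivFunOnFinite.symm f), by ext g; simp [hf]⟩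

theorem exists_pow_smul_of_pow_smul_eq_zero [Finite G] (hR : IsFiniteChainRing R) {γ : R}
    (hγ : (Ideal.span {γ}).IsMaximal) {j k : ℕ} (hjk : j + k ≤ nilpotencyClass γ)
    {x : AddMonoidAlgebra R G} (h : γ ^ k • x = 0) : ∃ y, x = γ ^ j • y := by
  refine exists_smul_eq_of_forall_dvd fun g => hR.dvd_of_pow_mul_eq_zero hγ hjk ?_
  simpa using congrArg (fun z => z.coeff g) h

theorem mapRingHom_rev {S : Type*} [CommRing S] (f : R →+* S) (x : AddMonoidAlgebra R G) :
    mapRingHom G f (rev x) = rev (mapRingHom G f x) := by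
  ext g
  simp [coeff_rev]

theorem exists_smul_eq_of_mapRingHom_eq_zero [Finite G] {S : Type*} [CommRing S] {f : R →+* S}
    {γ : R} (hf : RingHom.ker f = Ideal.span {γ}) {x : AddMonoidAlgebra R G}
    (h : mapRingHom G f x = 0) : ∃ y, x = γ • y := by
  refine exists_smul_eq_of_forall_dvd fun g => ?_
  rw [← Ideal.mem_span_singleton, ← hf, RingHom.mem_ker]
  simpa using congrArg (fun z => z.coeff g) h

end Basic

end AddMonoidAlgebra

namespace AddMonoidAlgebra

/-! ### Group algebras over finite fields -/

section FiniteField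

variable {K G : Type*} [Field K] [Finite K] [AddCommGroup G]

/-- Frobenius is additive, fixes the coefficients in K, and multiplies group elements by q^j. -/
theorem pow_card_pow_eq_mapDomain (x : AddMonoidAlgebra K G) (j : ℕ) :
    x ^ (Nat.card K ^ j) =
      mapDomainRingHom K (nsmulAddMonoidHom (Nat.card K ^ j) : G →+ G) x := by
  have := Fintype.ofFinite K
  obtain ⟨p, hc, r, hp, hr⟩ := FiniteField.card' K
  have : Fact p.Prime := ⟨hp⟩
  have : CharP (AddMonoidAlgebra K G) p :=
    charP_of_injective_algebraMap (algebraMap K (AddMonoidAlgebra K G)).injective p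
  have hq : Nat.card K ^ j = p ^ (r * j) := by rw [Nat.card_eq_fintype_card, hr, pow_mul]
  induction x using induction_linear with
  | zero => simp
  | add x y hx hy => rw [map_add, ← hx, ← hy, hq, add_pow_char_pow]
  | single g s =>
    rw [single_pow, Nat.card_eq_fintype_card, FiniteField.pow_card_pow]
    simp

theorem isReduced_of_card_pow_smul {t : ℕ} (ht : 0 < t)
    (h : ∀ g : G, (Nat.card K ^ t) • g = g) : IsReduced (AddMonoidAlgebra K G) := by
  rw [isReduced_iff_pow_one_lt (Nat.card K ^ t) (Nat.one_lt_pow ht.ne' Finite.one_lt_card)]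
  intro x hx
  rw [pow_card_pow_eq_mapDomain] at hx
  rw [← hx, show (nsmulAddMonoidHom (Nat.card K ^ t) : G →+ G) = AddMonoidHom.id G from
    AddMonoidHom.ext h]
  simp

/-- Here `rev` is a Frobenius power, so x * rev x = x^(q^j + 1). -/
theorem eq_zero_of_mul_rev_eq_zero [IsReduced (AddMonoidAlgebra K G)] {j : ℕ}
    (h : ∀ g : G, (Nat.card K ^ j) • g = -g) {x : AddMonoidAlgebra K G}
    (hx : x * rev x = 0) : x = 0 := by
  have : rev x = x ^ (Nat.card K ^ j) := by
    rw [pow_card_pow_eq_mapDomain, rev]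
    congr 2
    exact AddMonoidHom.ext fun g => (h g).symm
  rw [this, ← pow_succ'] at hx
  exact eq_zero_of_pow_eq_zero hx

end FiniteField

/-- If a^N is idempotent, a(1 - a^N) is nilpotent, hence 0; so a = a * a^N lies in M², and a
finitely generated ideal with M = M² is generated by an idempotent. -/
theorem exists_idempotent_span_of_isReduced {A : Type*} [CommRing A] [Finite A] [IsReduced A]
    (M : Ideal A) : ∃ c, IsIdempotentElem c ∧ M = Ideal.span {c} := by
  refine (Ideal.isIdempotentElem_iff_of_fg M (IsNoetherian.noetherian M)).1 ?_
  refine le_antisymm Ideal.mul_le_right fun a ha => ?_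
  obtain ⟨N, hN, hf⟩ := exists_pow_isIdempotentElem a
  have h : (a * (1 - a ^ N)) ^ N = 0 := by
    obtain ⟨k, rfl⟩ := Nat.exists_eq_succ_of_ne_zero hN.ne'
    rw [mul_pow, pow_succ (1 - _), mul_left_comm, mul_sub, mul_one, hf.eq, sub_self, mul_zero]
  have h' := eq_zero_of_pow_eq_zero h
  rw [mul_sub, mul_one, sub_eq_zero] at h'
  rw [h']
  exact Ideal.mul_mem_mul ha (Ideal.pow_mem_of_mem M ha N hN)

/-- If `-1` is not a power of `|K|` modulo `n`, then some nonzero element of the group algebra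
of `ZMod n` over `K` is orthogonal to all its cyclic shifts. -/
theorem exists_ne_zero_mul_rev_eq_zero {K : Type*} [Field K] [Finite K] {n : ℕ} [NeZero n]
    (hn : (n : K) ≠ 0) [IsReduced (AddMonoidAlgebra K (ZMod n))]
    (h : ∀ j, (Nat.card K : ZMod n) ^ j ≠ -1) :
    ∃ x : AddMonoidAlgebra K (ZMod n), x ≠ 0 ∧ x * rev x = 0 := by
  have : NeZero (n : K) := ⟨hn⟩
  have := Fintype.ofFinite K
  let L := CyclotomicField n K
  have : FiniteDimensional K L := IsCyclotomicExtension.finiteDimensional {n} K L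
  have : IsGalois K L := IsCyclotomicExtension.isGalois {n} K L
  have : Finite L := Module.finite_of_finite K
  have : Finite (AddMonoidAlgebra K (ZMod n)) := finite
  set ζ : L := IsCyclotomicExtension.zeta n K L
  have hζ : IsPrimitiveRoot ζ n := IsCyclotomicExtension.zeta_spec n K L
  let φ : AddMonoidAlgebra K (ZMod n) →ₐ[K] L :=
    AddMonoidAlgebra.lift K L (ZMod n) (AddChar.zmodChar n hζ.pow_eq_one).toMonoidHom
  have hφ1 : φ (single 1 1) = ζ := by
    simp only [φ, lift_single, one_smul]
    change AddChar.zmodChar n hζ.pow_eq_one 1 = _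
    have h := AddChar.zmodChar_apply' hζ.pow_eq_one 1
    rwa [Nat.cast_one, pow_one] at h
  let revAlgHom : AddMonoidAlgebra K (ZMod n) →ₐ[K] AddMonoidAlgebra K (ZMod n) :=
    { rev with
      commutes' := fun r => by
        change rev (algebraMap K _ r) = algebraMap K _ r
        rw [Algebra.algebraMap_eq_smul_one, rev_smul, map_one] }
  have hφ2 : φ (rev (single 1 1)) = ζ⁻¹ := by
    refine eq_inv_of_mul_eq_one_left ?_
    rw [← hφ1]
    rw [← map_mul, rev_single, single_mul_single, neg_add_cancel, mul_one]
    exact map_one φ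
  let M := RingHom.ker φ.toRingHom
  have hM : M.IsMaximal := by
    have : M.IsPrime := RingHom.ker_isPrime _
    exact IsArtinianRing.isMaximal_of_isPrime M
  let M' := M.comap rev
  have hM' : M'.IsMaximal := Ideal.comap_isMaximal_of_surjective _
    (fun x => ⟨rev x, rev_rev x⟩)
  have hne : M ≠ M' := by
    intro hMM
    -- If `M = M'`, then ζ⁻¹ is a root of the minimal polynomial of ζ, so some Galois automorphism,
    -- a power of Frobenius, sends ζ to ζ⁻¹.
    obtain ⟨j, hj⟩ : ∃ j : ℕ, ζ ^ (Nat.card K ^ j) = ζ⁻¹ := by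
      have hmin : minpoly K ζ = minpoly K ζ⁻¹ := by
        refine minpoly.eq_of_irreducible_of_monic (minpoly.irreducible (.of_finite K ζ)) ?_
          (minpoly.monic (.of_finite K ζ))
        have h1 : Polynomial.aeval (single (1 : ZMod n) (1 : K)) (minpoly K ζ) ∈ M' := by
          rw [← hMM]
          change φ _ = 0
          rw [← Polynomial.aeval_algHom_apply, hφ1, minpoly.aeval]
        have h2 : (φ.comp revAlgHom) (Polynomial.aeval (single (1 : ZMod n) (1 : K))
          (minpoly K ζ)) = 0 := h1
        rwa [← Polynomial.aeval_algHom_apply, show (φ.comp revAlgHom) (single 1 1) = ζ⁻¹ from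
          hφ2] at h2
      obtain ⟨σ, hσ⟩ := (Normal.minpoly_eq_iff_mem_orbit L).1 hmin.symm
      obtain ⟨j, rfl⟩ := (FiniteField.bijective_frobeniusAlgEquivOfAlgebraic_pow K L).2 σ
      refine ⟨j, ?_⟩
      have := hσ
      simp only [AlgEquiv.smul_def, AlgEquiv.coe_pow,
        FiniteField.coe_frobeniusAlgEquivOfAlgebraic_iterate] at this
      rw [Nat.card_eq_fintype_card, this]
    refine h j ?_
    have h1 : ζ ^ (Nat.card K ^ j + 1) = 1 := by
      rw [pow_succ, hj, inv_mul_cancel₀ (hζ.ne_zero (NeZero.ne n))]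
    have h2 := (ZMod.natCast_eq_zero_iff _ _).2 (hζ.dvd_of_pow_eq_one _ h1)
    push_cast at h2
    exact eq_neg_of_add_eq_zero_left h2
  obtain ⟨m, hm, m', hm', hmm⟩ := Submodule.mem_sup.1
    ((Ideal.eq_top_iff_one _).1 (hM.coprime_of_ne hM' hne))
  obtain ⟨c, hc, hcM⟩ := exists_idempotent_span_of_isReduced M
  have hker : ∀ y ∈ M, (1 - c) * y = 0 := by
    intro y hy
    rw [hcM, Ideal.mem_span_singleton] at hy
    obtain ⟨z, rfl⟩ := hy
    rw [← mul_assoc, sub_mul, hc.eq, one_mul, sub_self, zero_mul]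
  -- `1 - c` kills `M` and `rev (1 - c)` kills `M'`; since `M + M'` contains 1, their product is 0.
  refine ⟨1 - c, fun h0 => hM.ne_top ?_, ?_⟩
  · rw [Ideal.eq_top_iff_one, sub_eq_zero.1 h0, hcM]
    exact Ideal.mem_span_singleton_self c
  · have e1 : rev (1 - c) * m' = 0 := by
      rw [← rev_rev m', ← map_mul, hker _ hm', map_zero]
    calc (1 - c) * rev (1 - c) = (1 - c) * m * rev (1 - c) + (1 - c) * (rev (1 - c) * m') := by
          rw [← mul_one ((1 - c) * rev (1 - c)), ← hmm]; ring
      _ = 0 := by rw [hker _ hm, e1]; simp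

end AddMonoidAlgebra

/-! ### Powers modulo odd prime powers -/

/-- An odd prime l cannot divide both z - 1 and z + 1, so all of l^a divides one of them. -/
theorem ZMod.eq_one_or_eq_neg_one_of_sq_eq_one {n : ℕ} (hn : IsPrimePow n) (hn_odd : Odd n)
    {x : ZMod n} (hx : x ^ 2 = 1) : x = 1 ∨ x = -1 := by
  obtain ⟨l, a, hl, ha, rfl⟩ := hn
  rw [← Nat.prime_iff] at hl
  obtain ⟨z, rfl⟩ := ZMod.intCast_surjective x
  have hl2 : l ≠ 2 := by
    rintro rfl
    rw [Nat.odd_pow_iff ha.ne'] at hn_odd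
    exact absurd hn_odd (by decide)
  have hdvd : ((l : ℤ) ^ a) ∣ (z - 1) * (z + 1) := by
    have : (((z - 1) * (z + 1) : ℤ) : ZMod (l ^ a)) = 0 := by
      push_cast
      linear_combination hx
    exact_mod_cast (ZMod.intCast_zmod_eq_zero_iff_dvd _ _).1 this
  have hlz : Prime (l : ℤ) := Nat.prime_iff_prime_int.1 hl
  by_cases h : (l : ℤ) ∣ z - 1
  · left
    have h' : ¬ (l : ℤ) ∣ z + 1 := fun h' => by
      have h2 : (l : ℤ) ∣ 2 := by
        have := dvd_sub h' h
        rwa [show z + 1 - (z - 1) = 2 by ring] at this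
      exact hl2 ((Nat.prime_dvd_prime_iff_eq hl Nat.prime_two).1 (by exact_mod_cast h2))
    have := hlz.pow_dvd_of_dvd_mul_right a h' hdvd
    have h0 : ((z - 1 : ℤ) : ZMod (l ^ a)) = 0 :=
      (ZMod.intCast_zmod_eq_zero_iff_dvd _ _).2 (by exact_mod_cast this)
    push_cast at h0
    exact sub_eq_zero.1 h0
  · right
    have := hlz.pow_dvd_of_dvd_mul_left a h hdvd
    have h0 : ((z + 1 : ℤ) : ZMod (l ^ a)) = 0 :=
      (ZMod.intCast_zmod_eq_zero_iff_dvd _ _).2 (by exact_mod_cast this)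
    push_cast at h0
    exact eq_neg_of_add_eq_zero_left h0

/-- If the order is 2k, then q^k is a square root of 1 other than 1. If it is odd, raising q^j = -1
to the order gives -1 = 1. -/
theorem ZMod.odd_orderOf_iff_forall_pow_ne_neg_one {n : ℕ} (hn : IsPrimePow n) (hn_odd : Odd n)
    {q : ℕ} (hq : q.Coprime n) :
    Odd (orderOf (q : ZMod n)) ↔ ∀ j, (q : ZMod n) ^ j ≠ -1 := by
  have : NeZero n := ⟨hn.ne_zero⟩
  have h2 : 2 < n := by
    have := hn.one_lt
    obtain ⟨k, rfl⟩ := hn_odd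
    omega
  have : Fact (2 < n) := ⟨h2⟩
  constructor
  · intro hodd j hj
    have h1 : ((q : ZMod n) ^ j) ^ orderOf (q : ZMod n) = 1 := by
      rw [← pow_mul, mul_comm, pow_mul, pow_orderOf_eq_one, one_pow]
    rw [hj, hodd.neg_one_pow] at h1
    exact ZMod.neg_one_ne_one h1
  · intro h
    by_contra hodd
    obtain ⟨k, hk⟩ := Nat.not_odd_iff_even.1 hodd
    have hpos : 0 < orderOf (q : ZMod n) :=
      orderOf_pos_iff.2 (isOfFinOrder_iff_pow_eq_one.2
        ⟨n.totient, Nat.totient_pos.2 hn.pos, by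
          exact_mod_cast (ZMod.natCast_eq_natCast_iff _ _ _).2 (Nat.ModEq.pow_totient hq)⟩)
    have hsq : ((q : ZMod n) ^ k) ^ 2 = 1 := by
      rw [← pow_mul, mul_two, ← hk, pow_orderOf_eq_one]
    rcases ZMod.eq_one_or_eq_neg_one_of_sq_eq_one hn hn_odd hsq with h1 | h1
    · exact absurd (orderOf_le_of_pow_eq_one (by omega) h1) (by omega)
    · exact h k h1

namespace AddMonoidAlgebra

/-! ### Self-dual ideals in group rings over finite chain rings -/

section Chain

variable {R K G : Type*} [CommRing R] [Field K] [AddCommGroup G] [Finite G]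
  {π : R →+* K} {γ : R}

theorem exists_pow_smul_of_mul_rev_eq_zero (hR : IsFiniteChainRing R)
    (hγ : (Ideal.span {γ}).IsMaximal) (hπ : RingHom.ker π = Ideal.span {γ})
    [Finite K] [IsReduced (AddMonoidAlgebra K G)] {j : ℕ} (hj : ∀ g : G, (Nat.card K ^ j) • g = -g)
    {m : ℕ} (hm : nilpotencyClass γ = m + m) {x : AddMonoidAlgebra R G} (hx : x * rev x = 0) :
    ∃ y, x = γ ^ m • y := by
  suffices ∀ i ≤ m, ∃ y, x = γ ^ i • y from this m le_rfl
  intro i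
  induction i with
  | zero => exact fun _ => ⟨x, by simp⟩
  | succ i ih =>
    intro hi
    obtain ⟨y, rfl⟩ := ih (by omega)
    rw [rev_smul, smul_mul_smul_comm, ← pow_add] at hx
    -- γ^(2i) kills y * rev y and 2i + 1 ≤ 2m, so y * rev y is divisible by γ and vanishes over K;
    -- hence so does y, which frees one more factor γ.
    obtain ⟨z, hz⟩ := exists_pow_smul_of_pow_smul_eq_zero hR hγ (j := 1) (by omega) hx
    have hπγ : π γ = 0 := by
      rw [← RingHom.mem_ker, hπ]
      exact Ideal.mem_span_singleton_self γ
    have h0 : mapRingHom G π y = 0 := by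
      refine eq_zero_of_mul_rev_eq_zero hj ?_
      rw [← mapRingHom_rev, ← map_mul, hz]
      ext g
      simp [hπγ]
    obtain ⟨w, rfl⟩ := exists_smul_eq_of_mapRingHom_eq_zero hπ h0
    exact ⟨w, by rw [smul_smul, pow_succ]⟩

/-- Lift x arbitrarily and take an idempotent power E. Then E * rev E is idempotent and divisible by
the nilpotent γ, hence 0; E ≠ 0 because it reduces to a power of x in a reduced ring. -/
theorem exists_isIdempotentElem_mul_rev_eq_zero (hR : IsFiniteChainRing R)
    (hγ : (Ideal.span {γ}).IsMaximal) (hπ : RingHom.ker π = Ideal.span {γ})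
    (hπs : Function.Surjective π)
    [IsReduced (AddMonoidAlgebra K G)] {x : AddMonoidAlgebra K G} (hx0 : x ≠ 0)
    (hx : x * rev x = 0) :
    ∃ E : AddMonoidAlgebra R G, IsIdempotentElem E ∧ E ≠ 0 ∧ E * rev E = 0 := by
  have := hR.finite
  have : Finite (AddMonoidAlgebra R G) := finite
  obtain ⟨y, rfl⟩ : ∃ y, mapRingHom G π y = x := by
    choose s hs using hπs
    exact ⟨ofCoeff (Finsupp.equivFunOnFinite.symm fun g => s (x.coeff g)), by ext g; simp [hs]⟩
  obtain ⟨N, hN, hE⟩ := exists_pow_isIdempotentElem y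
  refine ⟨y ^ N, hE, fun h0 => hx0 ?_, ?_⟩
  · refine eq_zero_of_pow_eq_zero (n := N) ?_
    rw [← map_pow, h0, map_zero]
  · have hid : IsIdempotentElem (y ^ N * rev (y ^ N)) := hE.mul (hE.map rev)
    obtain ⟨z, hz⟩ : ∃ z, y ^ N * rev (y ^ N) = γ • z := by
      refine exists_smul_eq_of_mapRingHom_eq_zero hπ ?_
      rw [map_pow, ← mul_pow, map_pow, map_mul, mapRingHom_rev, hx, zero_pow hN.ne']
    obtain ⟨k, hk⟩ := hR.isNilpotent hγ
    rw [← hid.pow_succ_eq k, pow_succ, hz, smul_pow, hk, zero_smul, zero_mul]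

end Chain

end AddMonoidAlgebra

/-! ### Cyclic codes as ideals of the group ring -/

namespace LinearCode

open AddMonoidAlgebra

variable {R : Type*} [CommRing R] {k : ℕ}

/-- A word of length `k + 1`, seen as an element of the group ring of `ZMod (k + 1)`. -/
noncomputable def toGroupRing :
    (Fin (k + 1) → R) ≃ₗ[R] AddMonoidAlgebra R (ZMod (k + 1)) where
  -- `ZMod (k + 1)` unfolds to `Fin (k + 1)`, which is why lengths are written as k + 1.
  toFun u := ofCoeff (Finsupp.equivFunOnFinite.symm (u : ZMod (k + 1) → R))
  invFun x := (x.coeff : ZMod (k + 1) → R)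
  map_add' u v := by ext; rfl
  map_smul' r u := by ext; rfl
  left_inv u := rfl
  right_inv x := by ext; rfl

theorem toGroupRing_coeff (u : Fin (k + 1) → R) (i : ZMod (k + 1)) :
    (toGroupRing u).coeff i = u i := rfl

theorem toGroupRing_rotate (u : Fin (k + 1) → R) :
    toGroupRing (fun i => u ((finRotate (k + 1)).symm i)) = single 1 1 * toGroupRing u := by
  ext i
  rw [coeff_single_mul_apply, one_mul, toGroupRing_coeff, toGroupRing_coeff]
  refine congrArg u ((finRotate_symm_apply (n := k + 1) i).trans ?_)
  exact sub_eq_neg_add (α := ZMod (k + 1)) i 1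

theorem coeff_toGroupRing_mul_rev_zero (u v : Fin (k + 1) → R) :
    (toGroupRing u * rev (toGroupRing v)).coeff 0 = u ⬝ᵥ v := by
  rw [coeff_mul_rev]
  simp only [sub_zero]
  rfl

theorem IsCyclic.exists_single_mul {C : LinearCode R (k + 1)} (hC : C.IsCyclic)
    {v : Fin (k + 1) → R} (hv : v ∈ C) (j : ℕ) :
    ∃ w ∈ C, toGroupRing w = single (j : ZMod (k + 1)) 1 * toGroupRing v := by
  induction j with
  | zero => exact ⟨v, hv, by rw [Nat.cast_zero, ← one_def, one_mul]⟩
  | succ j ih =>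
    obtain ⟨w, hw, h⟩ := ih
    refine ⟨_, hC w hw, ?_⟩
    rw [toGroupRing_rotate, h, ← mul_assoc, single_mul_single, one_mul, Nat.cast_succ,
      add_comm (1 : ZMod (k + 1))]

/-- The coefficient at g of the product is the inner product of u with v shifted by g. -/
theorem IsCyclic.mul_rev_eq_zero {C : LinearCode R (k + 1)} (hC : C.IsCyclic)
    {u v : Fin (k + 1) → R} (hu : u ∈ C.dual) (hv : v ∈ C) :
    toGroupRing u * rev (toGroupRing v) = 0 := by
  ext g
  obtain ⟨j, rfl⟩ := ZMod.natCast_zmod_surjective g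
  obtain ⟨w, hw, h⟩ := hC.exists_single_mul hv j
  have h1 := hu w hw
  rw [← coeff_toGroupRing_mul_rev_zero, h, map_mul, rev_single, mul_left_comm,
    coeff_single_mul_apply, one_mul, neg_neg, add_zero] at h1
  simpa using h1

/-- The cyclic code corresponding to an ideal of the group ring. -/
noncomputable def ofIdeal (I : Ideal (AddMonoidAlgebra R (ZMod (k + 1)))) :
    LinearCode R (k + 1) :=
  (I.restrictScalars R).comap toGroupRing.toLinearMap

theorem mem_ofIdeal {I : Ideal (AddMonoidAlgebra R (ZMod (k + 1)))} {u : Fin (k + 1) → R} :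
    u ∈ ofIdeal I ↔ toGroupRing u ∈ I := Iff.rfl

theorem isCyclic_ofIdeal (I : Ideal (AddMonoidAlgebra R (ZMod (k + 1)))) :
    (ofIdeal I).IsCyclic := by
  intro c hc
  rw [mem_ofIdeal, toGroupRing_rotate]
  exact I.mul_mem_left _ hc

theorem mem_dual_ofIdeal {I : Ideal (AddMonoidAlgebra R (ZMod (k + 1)))} {u : Fin (k + 1) → R} :
    u ∈ (ofIdeal I).dual ↔ ∀ x ∈ I, toGroupRing u * rev x = 0 := by
  constructor
  · intro hu x hx
    obtain ⟨v, rfl⟩ := toGroupRing.surjective x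
    exact (isCyclic_ofIdeal I).mul_rev_eq_zero hu hx
  · intro h v hv
    rw [← coeff_toGroupRing_mul_rev_zero, h (toGroupRing v) hv]
    rfl

theorem mem_trivialSelfDual {n : ℕ} {γ : R} {e : ℕ} {u : Fin n → R} :
    u ∈ trivialSelfDual n γ e ↔ ∃ v, u = γ ^ (e / 2) • v := by
  have hrow (i : Fin n) : (γ ^ (e / 2) • (1 : Matrix (Fin n) (Fin n) R)).row i =
      γ ^ (e / 2) • Pi.single i 1 := by
    ext j
    simp [Matrix.one_apply, Pi.single_apply, eq_comm]
  rw [trivialSelfDual, Submodule.mem_span_range_iff_exists_fun]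
  refine exists_congr fun v => ?_
  rw [eq_comm]
  suffices ∑ i, v i • (γ ^ (e / 2) • (1 : Matrix (Fin n) (Fin n) R)).row i = γ ^ (e / 2) • v by
    rw [this]
  ext j
  simp [hrow, Pi.single_apply, mul_comm]

theorem trivialSelfDual_le_dual {n : ℕ} {γ : R} {e : ℕ} {C : LinearCode R n}
    (hC : C ≤ trivialSelfDual n γ e) (h : γ ^ (e / 2) * γ ^ (e / 2) = 0) :
    trivialSelfDual n γ e ≤ C.dual := by
  intro u hu v hv
  obtain ⟨u', rfl⟩ := mem_trivialSelfDual.1 hu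
  obtain ⟨v', rfl⟩ := mem_trivialSelfDual.1 (hC hv)
  rw [smul_dotProduct, dotProduct_smul, smul_smul, h, zero_smul]

/-- E, rev E and F = 1 - E - rev E are orthogonal idempotents with sum 1. The ideal is everything on
the E-part, γ^m times everything on the F-part, and 0 on the rev E-part. Duality swaps the parts of
E and rev E and, since `rev` fixes F, replaces γ^m on the F-part by its annihilator, again generated
by γ^m. -/
theorem isSelfDual_ofIdeal_span_pair (hR : IsFiniteChainRing R) {γ : R}
    (hγ : (Ideal.span {γ}).IsMaximal) {m : ℕ} (hm : nilpotencyClass γ = m + m)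
    {E : AddMonoidAlgebra R (ZMod (k + 1))} (hE : IsIdempotentElem E) (hEE : E * rev E = 0) :
    (ofIdeal (Ideal.span {E, γ ^ m • (1 - E - rev E)})).IsSelfDual := by
  have hE' : rev E * rev E = rev E := (hE.map rev).eq
  have hE1 : E * E = E := hE.eq
  have hγ0 : γ ^ m * γ ^ m = 0 := by
    rw [← pow_add, ← hm]
    exact pow_nilpotencyClass (hR.isNilpotent hγ)
  set s := algebraMap R (AddMonoidAlgebra R (ZMod (k + 1))) (γ ^ m) with hs_def
  have hs : s * s = 0 := by rw [hs_def, ← map_mul, hγ0, map_zero]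
  refine le_antisymm (fun u hu => mem_dual_ofIdeal.2 fun x hx => ?_) fun u hu => ?_
  · rw [mem_ofIdeal] at hu
    obtain ⟨a, b, hab⟩ := Ideal.mem_span_pair.1 hu
    obtain ⟨c, d, rfl⟩ := Ideal.mem_span_pair.1 hx
    rw [← hab]
    simp only [map_add, map_mul, rev_smul, map_sub, map_one, rev_rev]
    simp only [Algebra.smul_def, ← hs_def]
    linear_combination (a * rev c - a * rev d * s - b * rev c * s) * hEE - a * rev d * s * hE1 -
      b * rev c * s * hE' + b * rev d * (1 - E - rev E) ^ 2 * hs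
  · rw [mem_dual_ofIdeal] at hu
    rw [mem_ofIdeal]
    have h1 := hu E (Ideal.subset_span (by simp))
    have h2 := hu (γ ^ m • (1 - E - rev E)) (Ideal.subset_span (by simp))
    rw [rev_smul, mul_smul_comm] at h2
    obtain ⟨w, hw⟩ := exists_pow_smul_of_pow_smul_eq_zero hR hγ hm.ge h2
    simp only [map_sub, map_one, rev_rev, Algebra.smul_def, ← hs_def] at hw
    -- u = uE + uF because u * rev E = 0, and uF = γ^m w = γ^m w F.
    refine Ideal.mem_span_pair.2 ⟨toGroupRing u, w, ?_⟩
    rw [Algebra.smul_def, ← hs_def]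
    linear_combination -(1 - E - rev E) * hw + toGroupRing u * hE1 + toGroupRing u * hE' +
      2 * toGroupRing u * hEE - h1

end LinearCode

/-- The characterization of the existence of nontrivial cyclic self-dual codes, for the residue
field given as the codomain of a surjective ring homomorphism. -/
theorem LinearCode.exists_isCyclic_isSelfDual_ne_trivial_iff {R K : Type*} [CommRing R] [Field K]
    [Finite K] (hR : IsFiniteChainRing R) {γ : R} (hγ : (Ideal.span {γ}).IsMaximal)
    {π : R →+* K} (hπ : RingHom.ker π = Ideal.span {γ}) (hπs : Function.Surjective π)
    {e : ℕ} (he : nilpotencyClass γ = e) (he_even : Even e)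
    {p r : ℕ} (hK : Nat.card K = p ^ r)
    {n : ℕ} (hn : IsPrimePow n) (hn_odd : Odd n) (hpn : p.Coprime n) :
    (∃ C : LinearCode R n, C.IsCyclic ∧ C.IsSelfDual ∧ C ≠ LinearCode.trivialSelfDual n γ e) ↔
      Odd (orderOf ((p ^ r : ℕ) : ZMod n)) := by
  have hq : (p ^ r).Coprime n := hpn.pow_left r
  rw [ZMod.odd_orderOf_iff_forall_pow_ne_neg_one hn hn_odd hq]
  obtain ⟨k, rfl⟩ := Nat.exists_eq_succ_of_ne_zero hn.ne_zero
  obtain ⟨m, rfl⟩ := he_even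
  have hm2 : (m + m) / 2 = m := by omega
  have hγ0 : γ ^ m * γ ^ m = 0 := by
    rw [← pow_add, ← he]
    exact pow_nilpotencyClass (hR.isNilpotent hγ)
  have hsmul : ∀ (j : ℕ) (g : ZMod (k + 1)),
      (Nat.card K ^ j) • g = ((p ^ r : ℕ) : ZMod (k + 1)) ^ j * g := by
    intro j g
    rw [nsmul_eq_mul, hK, Nat.cast_pow]
  have hred : IsReduced (AddMonoidAlgebra K (ZMod (k + 1))) := by
    refine AddMonoidAlgebra.isReduced_of_card_pow_smul (Nat.totient_pos.2 hn.pos) fun g => ?_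
    rw [hsmul, ← Nat.cast_pow,
      (ZMod.natCast_eq_natCast_iff _ _ _).2 (Nat.ModEq.pow_totient hq), Nat.cast_one, one_mul]
  constructor
  · rintro ⟨C, hC, hdual, hne⟩ j hj
    have hle : C ≤ LinearCode.trivialSelfDual (k + 1) γ (m + m) := by
      intro u hu
      have h0 := hC.mul_rev_eq_zero (hdual.le hu) hu
      obtain ⟨y, hy⟩ := AddMonoidAlgebra.exists_pow_smul_of_mul_rev_eq_zero hR hγ hπ (j := j)
        (fun g => by rw [hsmul, hj, neg_one_mul]) he h0
      refine LinearCode.mem_trivialSelfDual.2 ⟨LinearCode.toGroupRing.symm y, ?_⟩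
      rw [hm2, ← map_smul, ← hy, LinearEquiv.symm_apply_apply]
    refine hne (le_antisymm hle ?_)
    exact (LinearCode.trivialSelfDual_le_dual hle (by rwa [hm2])).trans hdual.ge
  · intro h
    -- |K| vanishes in K; if n did too, a Bézout relation between these coprime integers would give
    -- 1 = 0 in K.
    have hnK : ((k + 1 : ℕ) : K) ≠ 0 := by
      intro h0
      have hpK : ((p ^ r : ℕ) : K) = 0 := by
        have := Fintype.ofFinite K
        rw [← hK, Nat.card_eq_fintype_card]
        exact Nat.cast_card_eq_zero K
      have := Nat.isCoprime_iff_coprime.2 hq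
      have := this.map (Int.castRingHom K)
      simp only [eq_intCast, Int.cast_natCast] at this
      rw [hpK, h0] at this
      exact not_isCoprime_zero_zero this
    obtain ⟨x, hx0, hx⟩ := AddMonoidAlgebra.exists_ne_zero_mul_rev_eq_zero hnK
      (fun j => by rw [hK]; exact h j)
    obtain ⟨E, hE, hE0, hEE⟩ := AddMonoidAlgebra.exists_isIdempotentElem_mul_rev_eq_zero hR hγ hπ
      hπs hx0 hx
    refine ⟨_, LinearCode.isCyclic_ofIdeal _,
      LinearCode.isSelfDual_ofIdeal_span_pair hR hγ he hE hEE, fun heq => hE0 ?_⟩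
    have hmem : LinearCode.toGroupRing.symm E ∈ LinearCode.trivialSelfDual (k + 1) γ (m + m) := by
      rw [← heq, LinearCode.mem_ofIdeal, LinearEquiv.apply_symm_apply]
      exact Ideal.subset_span (by simp)
    obtain ⟨v, hv⟩ := LinearCode.mem_trivialSelfDual.1 hmem
    rw [hm2, LinearEquiv.symm_apply_eq, map_smul] at hv
    -- E = E² would be a multiple of γ^(2m) = 0.
    rw [← hE.eq, hv, smul_mul_smul_comm, hγ0, zero_smul]

theorem mainTheorem3 {R : Type*} [CommRing R] (hR : IsFiniteChainRing R)
    (γ : R) (hγ : (Ideal.span {γ}).IsMaximal)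
    (e : ℕ) (he : nilpotencyClass γ = e) (he_even : Even e)
    (p r : ℕ) (hp : p.Prime) (hK : Nat.card (R ⧸ Ideal.span {γ}) = p ^ r)
    (n : ℕ) (hn : IsPrimePow n) (hn_odd : Odd n) (hpn : p.Coprime n) :
    (∃ C : LinearCode R n, C.IsCyclic ∧ C.IsSelfDual ∧ C ≠ LinearCode.trivialSelfDual n γ e) ↔
      Odd (orderOf ((p ^ r : ℕ) : ZMod n)) := by
  let : Field (R ⧸ Ideal.span {γ}) := Ideal.Quotient.field _
  have := hR.finite
  have : Finite (R ⧸ Ideal.span {γ}) := Finite.of_surjective _ Ideal.Quotient.mk_surjective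
  exact LinearCode.exists_isCyclic_isSelfDual_ne_trivial_iff hR hγ
    (π := Ideal.Quotient.mk (Ideal.span {γ})) (Ideal.mk_ker (I := Ideal.span {γ}))
    Ideal.Quotient.mk_surjective he he_even hK hn hn_odd hpn
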